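/- For $r \ge 1$ and a finite simple graph $G$, an $r$-list assignment is a map $L \colon V(G) \to 2^{\{1,\dots,r\}}$. For $d \ge 2$, a $(d,r)$-coloring of $G$ that respects $L$ is a map $\phi \colon V(G) \to \{1,\dots,r\}$ with $\phi(v) \in L(v)$ for every vertex $v$ and $\phi(u) \ne \phi(v)$ for all distinct vertices $u,v$ whose distance in $G$ is less than $d$ (vertices in different connected components are at distance $\infty$). For fixed $d$ and $r$, \textsc{List $(d,r)$-Coloring} is the problem of deciding, given a finite simple graph $G$ and an $r$-list assignment $L$ of $G$, whether $G$ has a $(d,r)$-coloring that respects $L$. The graph $kP_3$ is the disjoint union of $k$ copies of the path on three vertices, and $G$ is $kP_3$-free if it has no induced subgraph isomorphic to $kP_3$. \textbf{Theorem.} Let $d \ge 6$, $r \ge 1$ and $k \ge 1$ be fixed integers. Then \textsc{List $(d,r)$-Coloring} can be solved in polynomial time on $kP_3$-free graphs: there are an algorithm and a polynomial $q$ (depending on $d$, $r$, $k$ only) such that, for every $kP_3$-free graph $G$ and every $r$-list assignment $L$ of $G$, the algorithm, on input $(G,L)$ encoded as a binary word $w$ (the number of vertices in unary, the adjacency matrix,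 and the lists), halts after at most $q(|w|)$ steps and answers correctly whether $G$ has a $(d,r)$-coloring that respects $L$. Here algorithms are programs for a unit-cost random access machine whose only arithmetic operations are addition and truncated subtraction (polynomially equivalent to Turing machines). -/

import Mathlib

namespace DistCol

/-! ### Graphs: `kP₃`-free graphs and list `(d, r)`-colorings -/

/-- The graph `kP₃`: the disjoint union of `k` copies of the path on three vertices. -/
def kP3 (k : ℕ) : SimpleGraph (Fin k × Fin 3) where
  Adj x y := x.1 = y.1 ∧ (SimpleGraph.pathGraph 3).Adj x.2 y.2
  symm := ⟨fun _ _ h => ⟨h.1.symm, h.2.symm⟩⟩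
  loopless := ⟨fun _ h => h.2.ne rfl⟩

/-- `G` has no induced subgraph isomorphic to `kP₃`. -/
def IsKP3Free {V : Type*} (k : ℕ) (G : SimpleGraph V) : Prop :=
  ¬ (kP3 k).IsIndContained G

/-- `φ` is a `(d, r)`-coloring of `G`: distinct vertices at distance less than `d` in `G` receive
different colors. Distances are `∞` between different connected components. -/
def IsDRColoring {V : Type*} {r : ℕ} (d : ℕ) (G : SimpleGraph V) (φ : V → Fin r) : Prop :=
  ∀ u v : V, u ≠ v → G.edist u v < (d : ℕ∞) → φ u ≠ φ v

/-- `G` has a `(d, r)`-coloring that respects the `r`-list assignment `L`. -/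
def HasListDRColoring {V : Type*} {r : ℕ} (d : ℕ) (G : SimpleGraph V) (L : V → Finset (Fin r)) :
    Prop :=
  ∃ φ : V → Fin r, IsDRColoring d G φ ∧ ∀ v, φ v ∈ L v

/-- An instance of List `(d, r)`-Coloring: a finite simple graph, on the vertex set
`{0, …, n - 1}`, with an `r`-list assignment. The set of colors is `Fin r`. -/
structure Instance (r : ℕ) where
  n : ℕ
  graph : SimpleGraph (Fin n)
  lists : Fin n → Finset (Fin r)

open scoped Classical in
/-- The binary word presenting an instance to an algorithm: `n` in unary, closed by a `false`, then
the `n × n` adjacency matrix row by row, then the `n × r` incidence matrix between vertices and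
colors row by row. Its length is `n + 1 + n ^ 2 + n * r`. -/
noncomputable def Instance.encode {r : ℕ} (I : Instance r) : List Bool :=
  List.replicate I.n true ++ [false] ++
    ((List.finRange I.n).flatMap fun u =>
      (List.finRange I.n).map fun v => decide (I.graph.Adj u v)) ++
    ((List.finRange I.n).flatMap fun u =>
      (List.finRange r).map fun c => decide (c ∈ I.lists u))

/-! ### Polynomial time: a random access machine

The machine is a unit-cost random access machine, programmed by `while`-programs. Its memory holds
natural numbers in registers and in arrays, both numbered by `ℕ` (a program names only finitely
many of them). Besides access to the memory, the only arithmetic is addition and truncated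
subtraction; there is no multiplication, so that after `t` steps on an input of length `m` the numbers in memory have
`O(t + log m)` bits, and polynomial time on this machine agrees with polynomial time on Turing machines. -/

/-- The memory: `reg x` is the content of register `x`, and `arr a i` that of cell `i` of array
`a`. -/
@[ext] structure State where
  reg : ℕ → ℕ
  arr : ℕ → ℕ → ℕ

/-- Expressions: constants, registers, array cells, addition and truncated subtraction. -/
inductive Exp where
  | const (c : ℕ) : Exp
  | reg (x : ℕ) : Exp
  | cell (a : ℕ) (i : Exp) : Exp
  | plus (e f : Exp) : Exp
  | minus (e f : Exp) : Exp

/-- The value of an expression. -/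
def Exp.eval (s : State) : Exp → ℕ
  | const c => c
  | reg x => s.reg x
  | cell a i => s.arr a (i.eval s)
  | plus e f => e.eval s + f.eval s
  | minus e f => e.eval s - f.eval s

/-- The number of steps taken to evaluate an expression: one for each node of its tree. -/
def Exp.cost : Exp → ℕ
  | const _ => 1
  | reg _ => 1
  | cell _ i => i.cost + 1
  | plus e f => e.cost + f.cost + 1
  | minus e f => e.cost + f.cost + 1

/-- Programs. Conditions are expressions, and a nonzero value means true. -/
inductive Program where
  /-- do nothing -/
  | skip : Program
  /-- `x := e` -/
  | assign (x : ℕ) (e : Exp) : Program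
  /-- `a[i] := e` -/
  | store (a : ℕ) (i e : Exp) : Program
  /-- first `p`, then `q` -/
  | seq (p q : Program) : Program
  /-- if `e ≠ 0` then `p` else `q` -/
  | cond (e : Exp) (p q : Program) : Program
  /-- while `e ≠ 0` do `p` -/
  | loop (e : Exp) (p : Program) : Program

/-- The memory after `x := m`. -/
def State.setReg (s : State) (x m : ℕ) : State :=
  { s with reg := Function.update s.reg x m }

/-- The memory after `a[i] := m`. -/
def State.setCell (s : State) (a i m : ℕ) : State :=
  { s with arr := Function.update s.arr a (Function.update (s.arr a) i m) }

/-- `Exec p s s' t`: the program `p`, started with memory `s`, halts after exactly `t` steps with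
memory `s'`. -/
inductive Exec : Program → State → State → ℕ → Prop where
  | skip (s : State) : Exec .skip s s 1
  | assign (x : ℕ) (e : Exp) (s : State) :
      Exec (.assign x e) s (s.setReg x (e.eval s)) (e.cost + 1)
  | store (a : ℕ) (i e : Exp) (s : State) :
      Exec (.store a i e) s (s.setCell a (i.eval s) (e.eval s)) (i.cost + e.cost + 1)
  | seq {p q : Program} {s s' s'' : State} {t t' : ℕ} :
      Exec p s s' t → Exec q s' s'' t' → Exec (.seq p q) s s'' (t + t')
  | cond_true {e : Exp} {p q : Program} {s s' : State} {t : ℕ} :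
      e.eval s ≠ 0 → Exec p s s' t → Exec (.cond e p q) s s' (e.cost + 1 + t)
  | cond_false {e : Exp} {p q : Program} {s s' : State} {t : ℕ} :
      e.eval s = 0 → Exec q s s' t → Exec (.cond e p q) s s' (e.cost + 1 + t)
  | loop_done {e : Exp} {p : Program} {s : State} :
      e.eval s = 0 → Exec (.loop e p) s s (e.cost + 1)
  | loop_next {e : Exp} {p : Program} {s s' s'' : State} {t t' : ℕ} :
      e.eval s ≠ 0 → Exec p s s' t → Exec (.loop e p) s' s'' t' →
        Exec (.loop e p) s s'' (e.cost + 1 + t + t')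

/-- The initial memory on input `w`: register `0` holds the length of `w`, array `0` holds the
letters of `w` (`1` for `true`, `0` for `false`), and everything else is `0`. -/
def State.init (w : List Bool) : State where
  reg x := if x = 0 then w.length else 0
  arr a i := if a = 0 then (w.getD i false).toNat else 0

open scoped Classical in
/-- The decision problem with yes-instances `Yes`, whose instances `x` are presented as the words
`encode x`, can be solved in polynomial time on the class `C` of instances: there are one program
and one polynomial such that, on every instance in `C`, the program halts, within a number of
steps bounded by the polynomial in the length of the input word, with the answer in register `0`
(`1` for yes and `0` for no). -/
def PolyTimeSolvableOn {ι : Type*} (encode : ι → List Bool) (C Yes : ι → Prop) : Prop :=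
  ∃ (p : Program) (q : Polynomial ℕ), ∀ x : ι, C x →
    ∃ (s : State) (t : ℕ), Exec p (State.init (encode x)) s t ∧
      t ≤ q.eval (encode x).length ∧ s.reg 0 = if Yes x then 1 else 0

end DistCol

/-! A shortest path on `4 * k` vertices is induced, and dropping every fourth vertex leaves an
induced `kP₃`. So in a `kP₃`-free graph, vertices of the same component are at distance less than `4
* k` (`IsKP3Free.dist_lt`). If a coloring exists and `d ≥ 3`, the vertices of a closed neighborhood
have distinct colors, so there are at most `r` of them, and every component has at most `N = r ^ (4
* k)` vertices.

Hence `G` is colorable iff every vertex lies in an adjacency-closed set of at most `N` vertices that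
has a coloring (`LocallyColorable`). The backward direction holds in every graph: colorings chosen
component by component do not interact. Since `N` is fixed, this is a first-order sentence of fixed
size, and brute force decides it: `Evaluable` is closed under connectives, finite case distinctions
and quantification over vertices, each quantifier costing one loop of `n` rounds. -/

namespace DistCol

open Function

/-! ### Running programs -/

/-- A counting loop: if the invariant `Inv i` holds at the start of round `i`, and every round takes
at most `T` steps, then the loop stops after `n` rounds. -/
theorem Exec.exists_loop {e : Exp} {p : Program} {n T : ℕ} (Inv : ℕ → State → Prop)
    (hstep : ∀ i < n, ∀ s, Inv i s → e.eval s ≠ 0 ∧ ∃ s' t, Exec p s s' t ∧ t ≤ T ∧ Inv (i + 1) s')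
    (hdone : ∀ s, Inv n s → e.eval s = 0) (s : State) (h0 : Inv 0 s) :
    ∃ s' t, Exec (.loop e p) s s' t ∧ t ≤ n * (e.cost + 1 + T) + (e.cost + 1) ∧ Inv n s' := by
  suffices H : ∀ m i s, i + m = n → Inv i s →
      ∃ s' t, Exec (.loop e p) s s' t ∧ t ≤ m * (e.cost + 1 + T) + (e.cost + 1) ∧ Inv n s' from
    H n 0 s (by omega) h0
  intro m
  induction m with
  | zero =>
    intro i s hi h
    obtain rfl : i = n := by omega
    exact ⟨s, _, .loop_done (hdone s h), by omega, h⟩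
  | succ m ih =>
    intro i s hi h
    obtain ⟨he, s', t, hp, ht, h'⟩ := hstep i (by omega) s h
    obtain ⟨s'', t', hp', ht', h''⟩ := ih (i + 1) s' (by omega) h'
    refine ⟨s'', _, .loop_next he hp hp', ?_, h''⟩
    rw [Nat.succ_mul]
    omega

@[simp] theorem State.setReg_reg (s : State) (x m : ℕ) :
    (s.setReg x m).reg = update s.reg x m := rfl

@[simp] theorem State.setReg_arr (s : State) (x m : ℕ) : (s.setReg x m).arr = s.arr := rfl

@[simp] theorem State.setCell_reg (s : State) (a i m : ℕ) : (s.setCell a i m).reg = s.reg := rfl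

@[simp] theorem State.setCell_arr (s : State) (a i m : ℕ) :
    (s.setCell a i m).arr = update s.arr a (update (s.arr a) i m) := rfl

theorem Exec.assign' {x m : ℕ} {e : Exp} {s : State} (h : e.eval s = m) :
    Exec (.assign x e) s (s.setReg x m) (e.cost + 1) := h ▸ .assign x e s

theorem Exec.store' {a j m : ℕ} {i e : Exp} {s : State} (hi : i.eval s = j) (h : e.eval s = m) :
    Exec (.store a i e) s (s.setCell a j m) (i.cost + e.cost + 1) := h ▸ hi ▸ .store a i e s

theorem eval_mono (q : Polynomial ℕ) {m n : ℕ} (h : m ≤ n) : q.eval m ≤ q.eval n := by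
  simp only [Polynomial.eval_eq_sum, Polynomial.sum]
  exact Finset.sum_le_sum fun i _ => Nat.mul_le_mul_left _ (Nat.pow_le_pow_left h i)

/-! ### Reading the input -/

theorem getD_append_flatMap {α β : Type*} (d : β) (f : α → List β) (m : ℕ)
    (hf : ∀ a, (f a).length = m) (l : List α) (rest : List β) (i j : ℕ) (hi : i < l.length)
    (hj : j < m) : (l.flatMap f ++ rest).getD (i * m + j) d = (f l[i]).getD j d := by
  induction l generalizing i with
  | nil => simp at hi
  | cons a l ih =>
    rw [List.flatMap_cons, List.append_assoc]
    cases i with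
    | zero =>
      rw [List.getD_append _ _ _ _ (by rw [hf]; omega)]
      simp
    | succ i =>
      rw [List.getD_append_right _ _ _ _ (by rw [hf, Nat.succ_mul]; omega), hf,
        show (i + 1) * m + j - m = i * m + j by rw [Nat.succ_mul]; omega,
        ih i (by simpa using hi)]
      simp

theorem length_flatMap_finRange {β : Type*} {n m : ℕ} (f : Fin n → List β)
    (hf : ∀ a, (f a).length = m) : ((List.finRange n).flatMap f).length = n * m := by
  simp [List.length_flatMap, hf]

namespace Instance

variable {r : ℕ} (I : Instance r)

/-- Adjacency of vertices that are given as natural numbers. -/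
def NatAdj (u v : ℕ) : Prop := ∃ (hu : u < I.n) (hv : v < I.n), I.graph.Adj ⟨u, hu⟩ ⟨v, hv⟩

/-- The list assignment on vertices that are given as natural numbers. -/
def NatList (u : ℕ) (c : Fin r) : Prop := ∃ hu : u < I.n, c ∈ I.lists ⟨u, hu⟩

theorem length_encode : I.encode.length = I.n + 1 + I.n * I.n + I.n * r := by
  unfold encode
  rw [List.length_append, List.length_append, length_flatMap_finRange (m := I.n) _ (by simp),
    length_flatMap_finRange (m := r) _ (by simp)]
  simp

theorem n_le_length_encode : I.n ≤ I.encode.length := by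
  rw [length_encode]; omega

theorem encode_getD_lt {i : ℕ} (hi : i < I.n) : I.encode.getD i false = true := by
  unfold encode
  rw [List.append_assoc, List.append_assoc, List.getD_append _ _ _ _ (by simpa using hi)]
  simp [hi]

theorem encode_getD_n : I.encode.getD I.n false = false := by
  unfold encode
  rw [List.append_assoc, List.append_assoc, List.getD_append_right _ _ _ _ (by simp)]
  simp

theorem encode_getD_adj {u v : ℕ} (hu : u < I.n) (hv : v < I.n) :
    I.encode.getD (I.n + 1 + u * I.n + v) false = true ↔ I.NatAdj u v := by
  classical
  unfold encode
  rw [List.append_assoc, List.getD_append_right _ _ _ _ (by simp; omega)]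
  rw [show I.n + 1 + u * I.n + v - (List.replicate I.n true ++ [false]).length = u * I.n + v by
    simp; omega]
  rw [getD_append_flatMap _ _ I.n (by simp) _ _ _ _ (by simpa using hu) hv]
  simp [NatAdj, hu, hv]

theorem encode_getD_list {u : ℕ} (hu : u < I.n) (c : Fin r) :
    I.encode.getD (I.n + 1 + I.n * I.n + u * r + c) false = true ↔ I.NatList u c := by
  classical
  unfold encode
  rw [List.getD_append_right _ _ _ _ (by
    rw [List.length_append, length_flatMap_finRange (m := I.n) _ (by simp)]; simp; omega)]
  rw [List.length_append, length_flatMap_finRange (m := I.n) _ (by simp)]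
  rw [show I.n + 1 + I.n * I.n + u * r + c
    - ((List.replicate I.n true ++ [false]).length + I.n * I.n) = u * r + c by simp; omega]
  rw [← List.append_nil (List.flatMap _ _),
    getD_append_flatMap _ _ r (by simp) _ _ _ _ (by simpa using hu) c.2]
  simp [NatList, hu]

end Instance

/-- The memory holds the instance `I`, its number of vertices in register `1`, and the positions of
the rows of the two matrices in arrays `2` and `3`. -/
structure Ready {r : ℕ} (I : Instance r) (s : State) : Prop where
  reg_one : s.reg 1 = I.n
  input : ∀ i, s.arr 0 i = (I.encode.getD i false).toNat
  adjRow : ∀ u < I.n, s.arr 2 u = I.n + 1 + u * I.n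
  listRow : ∀ u < I.n, s.arr 3 u = I.n + 1 + I.n * I.n + u * r

/-! ### Predicates that are evaluated in polynomial time -/

open scoped Classical in
/-- The predicate `Q` on instances and assignments of natural numbers to variables can be evaluated
in polynomial time: array `1` holds the values of the variables, the answer goes to register `b`,
and arrays as well as registers below `b` do not change. -/
def Evaluable {r : ℕ} (Q : Instance r → (ℕ → ℕ) → Prop) : Prop :=
  ∃ (p : ℕ → Program) (q : Polynomial ℕ), ∀ (I : Instance r) (s : State) (b : ℕ), 2 ≤ b →
    Ready I s → ∃ s' t, Exec (p b) s s' t ∧ t ≤ q.eval I.n ∧ s'.arr = s.arr ∧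
      (∀ x < b, s'.reg x = s.reg x) ∧ s'.reg b = if Q I (s.arr 1) then 1 else 0

namespace Evaluable

variable {r : ℕ} {P Q : Instance r → (ℕ → ℕ) → Prop}

/-- The expression may take any nonzero value for true; the conditional normalizes it to `1`. -/
theorem of_exp (e : Exp) (h : ∀ I s, Ready I s → (e.eval s ≠ 0 ↔ Q I (s.arr 1))) :
    Evaluable Q := by
  refine ⟨fun b => .cond e (.assign b (.const 1)) (.assign b (.const 0)),
    Polynomial.C (e.cost + 1 + 2), fun I s b hb hs => ?_⟩
  rw [Polynomial.eval_C]
  by_cases he : e.eval s = 0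
  · refine ⟨_, _, .cond_false he (.assign _ _ _), le_rfl, rfl, fun x hx => ?_, ?_⟩
    · simp [hx.ne]
    · have : ¬ Q I (s.arr 1) := by rw [← h I s hs]; simpa using he
      simp [this, Exp.eval]
  · refine ⟨_, _, .cond_true he (.assign _ _ _), le_rfl, rfl, fun x hx => ?_, ?_⟩
    · simp [hx.ne]
    · have : Q I (s.arr 1) := by rw [← h I s hs]; simpa using he
      simp [this, Exp.eval]

theorem congr (hP : Evaluable P) (h : ∀ I e, P I e ↔ Q I e) : Evaluable Q := by
  have : P = Q := by ext I e; exact h I e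
  exact this ▸ hP

theorem eq (x y : ℕ) : Evaluable (r := r) fun _ e => e x = e y := by
  -- With truncated subtraction, `(a - b) + (b - a)` vanishes iff `a = b`, and `1 - z` negates.
  refine of_exp (.minus (.const 1) (.plus (.minus (.cell 1 (.const x)) (.cell 1 (.const y)))
    (.minus (.cell 1 (.const y)) (.cell 1 (.const x))))) fun I s _ => ?_
  simp only [Exp.eval]
  omega

theorem natAdj (x y : ℕ) : Evaluable (r := r) fun I e => I.NatAdj (e x) (e y) := by
  -- A conjunction: the sum of the negated conjuncts is zero. The bounds are tested because the row
  -- tables are specified only below `n`.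
  refine of_exp (.minus (.const 1) (.plus (.minus (.const 1) (.minus (.reg 1) (.cell 1 (.const x))))
    (.plus (.minus (.const 1) (.minus (.reg 1) (.cell 1 (.const y))))
      (.minus (.const 1) (.cell 0 (.plus (.cell 2 (.cell 1 (.const x))) (.cell 1 (.const y))))))))
    fun I s hs => ?_
  simp only [Exp.eval, hs.reg_one]
  by_cases hx : s.arr 1 x < I.n
  · by_cases hy : s.arr 1 y < I.n
    · rw [hs.adjRow _ hx, hs.input, ← I.encode_getD_adj hx hy]
      generalize I.encode.getD _ false = z
      cases z <;> (simp; omega)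
    · exact iff_of_false (by omega) fun h => hy h.2.1
  · exact iff_of_false (by omega) fun h => hx h.1

theorem natList (x : ℕ) (c : Fin r) : Evaluable fun I e => I.NatList (e x) c := by
  refine of_exp (.minus (.const 1) (.plus (.minus (.const 1) (.minus (.reg 1) (.cell 1 (.const x))))
    (.minus (.const 1) (.cell 0 (.plus (.cell 3 (.cell 1 (.const x))) (.const c))))))
    fun I s hs => ?_
  simp only [Exp.eval, hs.reg_one]
  by_cases hx : s.arr 1 x < I.n
  · rw [hs.listRow _ hx, hs.input, ← I.encode_getD_list hx c]
    generalize I.encode.getD _ false = z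
    cases z
    · simp
    · simp; omega
  · exact iff_of_false (by omega) fun h => hx h.1

theorem const (a : Prop) : Evaluable (r := r) fun _ _ => a := by
  by_cases ha : a
  · exact of_exp (.const 1) fun _ _ _ => by simp [Exp.eval, ha]
  · exact of_exp (.const 0) fun _ _ _ => by simp [Exp.eval, ha]

theorem not (hP : Evaluable P) : Evaluable fun I e => ¬ P I e := by
  obtain ⟨p, q, h⟩ := hP
  refine ⟨fun b => .seq (p b) (.assign b (.minus (.const 1) (.reg b))), q + Polynomial.C 4,
    fun I s b hb hs => ?_⟩
  obtain ⟨s', t, hp, ht, harr, hreg, hval⟩ := h I s b hb hs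
  refine ⟨_, _, .seq hp (.assign _ _ _), ?_, harr, fun x hx => ?_, ?_⟩
  · simp only [Exp.cost, Polynomial.eval_add, Polynomial.eval_C]; omega
  · simp [hx.ne, hreg x hx]
  · simp only [State.setReg_reg, update_self, Exp.eval, hval]
    split_ifs <;> simp_all

/-- The second program runs at `b + 1`, which protects the first answer in register `b`. -/
theorem and (hP : Evaluable P) (hQ : Evaluable Q) : Evaluable fun I e => P I e ∧ Q I e := by
  obtain ⟨p, q, h⟩ := hP
  obtain ⟨p', q', h'⟩ := hQ
  refine ⟨fun b => .seq (p b) (.seq (p' (b + 1)) (.assign b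
    (.minus (.plus (.reg b) (.reg (b + 1))) (.const 1)))), q + q' + Polynomial.C 6,
    fun I s b hb hs => ?_⟩
  obtain ⟨s₁, t₁, hp, ht, harr, hreg, hval⟩ := h I s b hb hs
  have hs₁ : Ready I s₁ := by
    constructor
    · rw [hreg 1 (by omega), hs.reg_one]
    all_goals rw [harr]
    exacts [hs.input, hs.adjRow, hs.listRow]
  obtain ⟨s₂, t₂, hp', ht', harr', hreg', hval'⟩ := h' I s₁ (b + 1) (by omega) hs₁
  refine ⟨_, _, .seq hp (.seq hp' (.assign _ _ _)), ?_, harr'.trans harr, fun x hx => ?_, ?_⟩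
  · simp only [Exp.cost, Polynomial.eval_add, Polynomial.eval_C]; omega
  · simp [hx.ne, hreg x hx, hreg' x (by omega)]
  · simp only [State.setReg_reg, update_self, Exp.eval, hval', harr, hreg' b (by omega), hval]
    split_ifs <;> simp_all

theorem or (hP : Evaluable P) (hQ : Evaluable Q) : Evaluable fun I e => P I e ∨ Q I e :=
  (hP.not.and hQ.not).not.congr fun _ _ => by tauto

theorem imp (hP : Evaluable P) (hQ : Evaluable Q) : Evaluable fun I e => P I e → Q I e :=
  (hP.not.or hQ).congr fun _ _ => by tauto

/-- Register `b` counts successes, `b + 1` is the loop counter, `b + 2` saves the old value of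
variable `x` so that array `1` can be restored, and the body answers in `b + 3`. -/
theorem existsLt (x : ℕ) (hP : Evaluable P) :
    Evaluable fun I e => ∃ i < I.n, P I (update e x i) := by
  classical
  obtain ⟨p, q, h⟩ := hP
  refine ⟨fun b => .seq (.assign b (.const 0)) (.seq (.assign (b + 1) (.const 0))
    (.seq (.assign (b + 2) (.cell 1 (.const x)))
    (.seq (.loop (.minus (.reg 1) (.reg (b + 1)))
      (.seq (.store 1 (.const x) (.reg (b + 1))) (.seq (p (b + 3))
        (.seq (.assign b (.plus (.reg b) (.reg (b + 3))))
          (.assign (b + 1) (.plus (.reg (b + 1)) (.const 1)))))))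
    (.seq (.store 1 (.const x) (.reg (b + 2)))
      -- `1 - (1 - z)` turns the success count into `0` or `1`.
      (.assign b (.minus (.const 1) (.minus (.const 1) (.reg b)))))))),
    Polynomial.X * (q + Polynomial.C 15) + Polynomial.C 24, fun I s b hb hs => ?_⟩
  -- Array `1` may differ from its initial content only at `x`; comparing the arrays after
  -- overwriting `x` says this.
  let Inv : ℕ → State → Prop := fun i s' =>
    (∀ y < b, s'.reg y = s.reg y) ∧ s'.reg (b + 1) = i ∧ s'.reg (b + 2) = s.arr 1 x ∧
      (∀ a ≠ 1, s'.arr a = s.arr a) ∧ (∀ m, update (s'.arr 1) x m = update (s.arr 1) x m) ∧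
      (s'.reg b ≠ 0 ↔ ∃ j < i, P I (update (s.arr 1) x j))
  have e₁ := Exec.assign' (x := b) (e := .const 0) (s := s) (m := 0) rfl
  have e₂ := Exec.assign' (x := b + 1) (e := .const 0) (s := s.setReg b 0) (m := 0) rfl
  have e₃ := Exec.assign' (x := b + 2) (e := .cell 1 (.const x))
    (s := (s.setReg b 0).setReg (b + 1) 0) (m := s.arr 1 x) rfl
  obtain ⟨s₁, t₁, e₄, ht₁, hreg, -, hsave, harr, hupd, hval⟩ := Exec.exists_loop
    (e := .minus (.reg 1) (.reg (b + 1)))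
    (T := q.eval I.n + 11) Inv (n := I.n) (p := (.seq (.store 1 (.const x) (.reg (b + 1)))
      (.seq (p (b + 3)) (.seq (.assign b (.plus (.reg b) (.reg (b + 3))))
          (.assign (b + 1) (.plus (.reg (b + 1)) (.const 1)))))))
    (by
      rintro i hi s₁ ⟨hreg, hcount, hsave, harr, hupd, hval⟩
      refine ⟨?_, ?_⟩
      · simp only [Exp.eval, hcount, hreg 1 (by omega), hs.reg_one]; omega
      have e₁ := Exec.store' (a := 1) (i := .const x) (e := .reg (b + 1)) (s := s₁) (j := x)
        (m := i) rfl hcount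
      have hs₁ : Ready I (s₁.setCell 1 x i) := by
        constructor
        · simp [hreg 1 (by omega), hs.reg_one]
        · simpa [harr 0] using hs.input
        · simpa [harr 2] using hs.adjRow
        · simpa [harr 3] using hs.listRow
      obtain ⟨s₂, t₂, e₂, ht₂, harr₂, hreg₂, hval₂⟩ := h I _ (b + 3) (by omega) hs₁
      refine ⟨_, _, .seq e₁ (.seq e₂ (.seq (.assign _ _ _) (.assign _ _ _))), ?_, ?_⟩
      · simp only [Exp.cost]; omega
      simp only [State.setCell_reg, State.setCell_arr, update_self, hupd] at hreg₂ harr₂ hval₂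
      refine ⟨fun y hy => ?_, ?_, ?_, fun a ha => ?_, fun m => ?_, ?_⟩
      · have : y ≠ b + 1 := by omega
        simp [this, hy.ne, hreg₂ y (by omega), hreg y hy]
      · simp [Exp.eval, hreg₂ (b + 1) (by omega), hcount]
      · simp [hreg₂ (b + 2) (by omega), hsave]
      · simp [harr₂, ha, harr a ha]
      · simp [harr₂]
      · simp only [State.setReg_reg, ne_eq, Nat.left_eq_add, one_ne_zero, not_false_eq_true,
          update_of_ne, update_self, Exp.eval, hreg₂ b (by omega), hval₂]
        rw [Nat.add_eq_zero_iff, not_and_or, ← ne_eq (s₁.reg b), hval]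
        constructor
        · rintro (⟨j, hj, hP⟩ | hP)
          · exact ⟨j, by omega, hP⟩
          · exact ⟨i, by omega, by simpa using hP⟩
        · rintro ⟨j, hj, hP⟩
          rcases Nat.lt_succ_iff_lt_or_eq.1 hj with hj | rfl
          · exact .inl ⟨j, hj, hP⟩
          · exact .inr (by simpa using hP))
    (by
      rintro s₁ ⟨hreg, hcount, -⟩
      simp [Exp.eval, hcount, hreg 1 (by omega), hs.reg_one])
    (((s.setReg b 0).setReg (b + 1) 0).setReg (b + 2) (s.arr 1 x))
    (by
      refine ⟨fun y hy => ?_, by simp, by simp, by simp, by simp, by simp⟩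
      have h₁ : y ≠ b + 1 := by omega
      have h₂ : y ≠ b + 2 := by omega
      simp [h₁, h₂, hy.ne])
  have e₅ := Exec.store' (a := 1) (i := .const x) (e := .reg (b + 2)) (s := s₁) (j := x)
    (m := s.arr 1 x) rfl hsave
  refine ⟨_, _, .seq e₁ (.seq e₂ (.seq e₃ (.seq e₄ (.seq e₅ (.assign _ _ _))))), ?_, ?_,
    fun y hy => ?_, ?_⟩
  · simp only [Exp.cost, Polynomial.eval_add, Polynomial.eval_mul, Polynomial.eval_X,
      Polynomial.eval_C] at ht₁ ⊢
    rw [show 1 + 1 + 1 + 1 + (q.eval I.n + 11) = q.eval I.n + 15 by omega] at ht₁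
    omega
  · funext a
    by_cases ha : a = 1
    · subst ha; simp [hupd]
    · simp [ha, harr a ha]
  · simp [hy.ne, hreg y hy]
  · simp only [State.setReg_reg, update_self, Exp.eval, State.setCell_reg]
    by_cases hc : s₁.reg b = 0
    · rw [if_neg (by rw [← hval]; simpa using hc)]; omega
    · rw [if_pos (hval.1 hc)]; omega

theorem forallLt (x : ℕ) (hP : Evaluable P) :
    Evaluable fun I e => ∀ i < I.n, P I (update e x i) :=
  (hP.not.existsLt x).not.congr fun _ _ => by simp

theorem finset_exists {ι : Type*} (A : Finset ι) {P : ι → Instance r → (ℕ → ℕ) → Prop}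
    (hP : ∀ i, Evaluable (P i)) : Evaluable fun I e => ∃ i ∈ A, P i I e := by
  classical
  induction A using Finset.induction_on with
  | empty => exact (const False).congr fun _ _ => by simp
  | insert a A _ ih => exact ((hP a).or ih).congr fun _ _ => by simp

theorem exists_fintype {ι : Type*} [Fintype ι] {P : ι → Instance r → (ℕ → ℕ) → Prop}
    (hP : ∀ i, Evaluable (P i)) : Evaluable fun I e => ∃ i, P i I e :=
  (finset_exists Finset.univ hP).congr fun _ _ => by simp

theorem forall_fintype {ι : Type*} [Fintype ι] {P : ι → Instance r → (ℕ → ℕ) → Prop}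
    (hP : ∀ i, Evaluable (P i)) : Evaluable fun I e => ∀ i, P i I e :=
  (exists_fintype fun i => (hP i).not).not.congr fun _ _ => by simp

/-- These are `N` nested loops, which is polynomial because `N` is fixed. Only the values of `f`
below `N` matter. -/
theorem exists_tuple (N : ℕ) (hP : Evaluable P) :
    Evaluable fun I e => ∃ f : ℕ → ℕ, (∀ i < N, f i < I.n) ∧
      P I fun j => if j < N then f j else e j := by
  induction N generalizing P with
  | zero => exact hP.congr fun _ _ => by simp
  | succ N ih =>
    refine (ih (hP.existsLt N)).congr fun I e => ⟨?_, ?_⟩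
    · rintro ⟨f, hf, i, hi, h⟩
      refine ⟨update f N i, fun j hj => ?_, ?_⟩
      · rcases Nat.lt_succ_iff_lt_or_eq.1 hj with hj | rfl
        · simpa [hj.ne] using hf j hj
        · simpa using hi
      · convert h using 1
        funext j
        by_cases hj : j = N
        · subst hj; simp
        · simp [hj, show j < N + 1 ↔ j < N by omega]
    · rintro ⟨f, hf, h⟩
      refine ⟨f, fun i hi => hf i (by omega), f N, hf N (by omega), ?_⟩
      convert h using 1
      funext j
      by_cases hj : j = N
      · subst hj; simp
      · simp [hj, show j < N + 1 ↔ j < N by omega]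

/-- A predicate without free variables that can be evaluated in polynomial time can be decided in
polynomial time. -/
theorem polyTimeSolvableOn (hP : Evaluable P) (C Yes : Instance r → Prop)
    (hYes : ∀ I, C I → (Yes I ↔ ∀ e, P I e)) (hconst : ∀ I e e', P I e → P I e') :
    PolyTimeSolvableOn (Instance.encode (r := r)) C Yes := by
  classical
  obtain ⟨p, q, h⟩ := hP
  -- The first `false` of the input is at position `n`, where the scan stops.
  let scan : Program := .loop (.cell 0 (.reg 1)) (.assign 1 (.plus (.reg 1) (.const 1)))
  -- Row offsets accumulate in register `3` by repeated addition, as there is no multiplication.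
  -- After the adjacency rows it holds the start of the list matrix, so it is not reset between the
  -- two fills.
  let fill (a : ℕ) (m : Exp) : Program := .loop (.minus (.reg 1) (.reg 2))
    (.seq (.store a (.reg 2) (.reg 3)) (.seq (.assign 3 (.plus (.reg 3) m))
      (.assign 2 (.plus (.reg 2) (.const 1)))))
  have hfill : ∀ (a k c n : ℕ) (m : Exp), m.cost = 1 → ∀ s : State, s.reg 1 = n → s.reg 2 = 0 →
      s.reg 3 = c → (∀ s' : State, s'.reg 1 = n → m.eval s' = k) → ∃ s' t, Exec (fill a m) s s' t ∧
        t ≤ n * 15 + 4 ∧ s'.reg 1 = n ∧ s'.reg 3 = c + n * k ∧ (∀ u < n, s'.arr a u = c + u * k) ∧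
        ∀ a' ≠ a, s'.arr a' = s.arr a' := by
    intro a k c n m hm s h1 h2 h3 hk
    let Inv : ℕ → State → Prop := fun i s' => s'.reg 1 = n ∧ s'.reg 2 = i ∧
      s'.reg 3 = c + i * k ∧ (∀ u < i, s'.arr a u = c + u * k) ∧ ∀ a' ≠ a, s'.arr a' = s.arr a'
    obtain ⟨s', t, e, ht, i1, i2, i3, i4, i5⟩ := Exec.exists_loop (n := n) (T := 11) Inv
      (e := .minus (.reg 1) (.reg 2)) (p := (.seq (.store a (.reg 2) (.reg 3))
        (.seq (.assign 3 (.plus (.reg 3) m)) (.assign 2 (.plus (.reg 2) (.const 1))))))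
      (by
        rintro i hi s' ⟨i1, i2, i3, i4, i5⟩
        refine ⟨by simp [Exp.eval, i1, i2]; omega, _, _,
          .seq (.store _ _ _ _) (.seq (.assign _ _ _) (.assign _ _ _)), ?_, ?_⟩
        · simp [Exp.cost, hm]
        refine ⟨by simp [i1], by simp [Exp.eval, i2], ?_, fun u hu => ?_, fun a' ha' => ?_⟩
        · have hk' : ∀ x y, m.eval (s'.setCell a x y) = k := fun _ _ => hk _ i1
          simp [Exp.eval, i3, hk', Nat.succ_mul, add_assoc]
        · rcases Nat.lt_succ_iff_lt_or_eq.1 hu with hu | rfl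
          · simp [Exp.eval, i2, i3, hu.ne, i4 u hu]
          · simp [Exp.eval, i2, i3]
        · simp [ha', i5 a' ha'])
      (by rintro s' ⟨i1, i2, -⟩; simp [Exp.eval, i1, i2]) s ⟨h1, h2, by simpa using h3, by simp, by simp⟩
    exact ⟨s', t, e, by simpa [Exp.cost] using ht, i1, i3, i4, i5⟩
  refine ⟨.seq scan (.seq (.assign 3 (.plus (.reg 1) (.const 1))) (.seq (fill 2 (.reg 1))
    (.seq (.assign 2 (.const 0)) (.seq (fill 3 (.const r)) (.seq (p 2) (.assign 0 (.reg 2))))))),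
    -- A round takes at most `7` steps in the scan and `15` in each of the two fills.
    q + Polynomial.X * Polynomial.C 37 + Polynomial.C 19, fun I hI => ?_⟩
  obtain ⟨s₁, t₁, e₁, ht₁, h1₁, h2₁, harr₁⟩ := Exec.exists_loop (n := I.n) (T := 4)
    (fun i s => s.reg 1 = i ∧ s.reg 2 = 0 ∧ s.arr = (State.init I.encode).arr)
    (e := .cell 0 (.reg 1)) (p := .assign 1 (.plus (.reg 1) (.const 1)))
    (by
      rintro i hi s ⟨i1, i2, i3⟩
      refine ⟨?_, _, _, .assign _ _ _, by simp [Exp.cost], by simp [Exp.eval, i1], by simp [i2],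
        by simp [i3]⟩
      simp only [Exp.eval, i1, i3, State.init, if_pos, I.encode_getD_lt hi]
      simp)
    (by
      rintro s ⟨i1, i2, i3⟩
      simp only [Exp.eval, i1, i3, State.init, if_pos, I.encode_getD_n]
      simp)
    (State.init I.encode) (by simp [State.init])
  have e₂ := Exec.assign' (x := 3) (e := .plus (.reg 1) (.const 1)) (s := s₁) (m := I.n + 1)
    (by simp [Exp.eval, h1₁])
  obtain ⟨s₃, t₃, e₃, ht₃, h1₃, h3₃, hrow₃, harr₃⟩ := hfill 2 I.n (I.n + 1) I.n (.reg 1) rfl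
    (s₁.setReg 3 (I.n + 1)) (by simp [h1₁]) (by simp [h2₁]) (by simp) (by simp [Exp.eval])
  have e₄ := Exec.assign' (x := 2) (e := .const 0) (s := s₃) (m := 0) rfl
  obtain ⟨s₅, t₅, e₅, ht₅, h1₅, h3₅, hrow₅, harr₅⟩ := hfill 3 r (I.n + 1 + I.n * I.n) I.n
    (.const r) rfl (s₃.setReg 2 0) (by simp [h1₃]) (by simp) (by simp [h3₃]) (by simp [Exp.eval])
  obtain ⟨s₆, t₆, e₆, ht₆, -, -, hval⟩ := h I s₅ 2 le_rfl
    { reg_one := h1₅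
      input := fun i => by
        rw [harr₅ 0 (by simp), State.setReg_arr, harr₃ 0 (by simp), State.setReg_arr, harr₁]
        simp [State.init]
      adjRow := fun u hu => by
        rw [harr₅ 2 (by simp), State.setReg_arr, hrow₃ u hu]
      listRow := hrow₅ }
  refine ⟨_, _, .seq e₁ (.seq e₂ (.seq e₃ (.seq e₄ (.seq e₅ (.seq e₆ (.assign _ _ _)))))), ?_, ?_⟩
  · have := eval_mono q I.n_le_length_encode
    have := I.n_le_length_encode
    simp only [Exp.cost, Polynomial.eval_add, Polynomial.eval_mul, Polynomial.eval_X,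
      Polynomial.eval_C] at ht₁ ⊢
    omega
  · simp only [State.setReg_reg, update_self, Exp.eval, hval]
    congr 1
    rw [hYes I hI]
    exact propext ⟨fun H e => hconst I _ e H, fun H => H _⟩

end Evaluable

/-! ### Components of `kP₃`-free graphs with a coloring are small -/

/-- Induction on the radius: a ball is covered by the balls of radius one less around the at most
`r` points of a closed neighborhood. -/
theorem exists_finset_walk_length_le {V : Type*} {G : SimpleGraph V} {r : ℕ}
    (h : ∀ u, ∃ A : Finset V, A.card ≤ r ∧ u ∈ A ∧ ∀ w, G.Adj u w → w ∈ A) (m : ℕ) (v : V) :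
    ∃ B : Finset V, B.card ≤ r ^ m ∧ ∀ u, ∀ p : G.Walk v u, p.length ≤ m → u ∈ B := by
  classical
  choose A hA hself hadj using h
  induction m generalizing v with
  | zero =>
    refine ⟨{v}, by simp, fun u p hp => ?_⟩
    simpa using (SimpleGraph.Walk.eq_of_length_eq_zero (Nat.le_zero.1 hp)).symm
  | succ m ih =>
    choose B hB hmem using ih
    refine ⟨(A v).biUnion B, ?_, fun u p hp => ?_⟩
    · calc _ ≤ (A v).card * r ^ m := Finset.card_biUnion_le_card_mul _ _ _ fun w _ => hB w
        _ ≤ r ^ (m + 1) := by rw [pow_succ']; exact Nat.mul_le_mul_right _ (hA v)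
    · rw [Finset.mem_biUnion]
      cases p with
      | nil => exact ⟨v, hself v, hmem _ _ .nil (by simp)⟩
      | cons e q => exact ⟨_, hadj _ _ e, hmem _ _ q (by simpa using hp)⟩

/-- Two vertices of a closed neighborhood are at distance at most `2 < d`, so `φ` is injective on
it. -/
theorem IsDRColoring.exists_finset_neighbors {V : Type*} [Fintype V] {d r : ℕ} (hd : 3 ≤ d)
    {G : SimpleGraph V} {φ : V → Fin r} (h : IsDRColoring d G φ) (u : V) :
    ∃ A : Finset V, A.card ≤ r ∧ u ∈ A ∧ ∀ w, G.Adj u w → w ∈ A := by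
  classical
  refine ⟨Finset.univ.filter fun w => w = u ∨ G.Adj u w, ?_, by simp, fun w hw => by simp [hw]⟩
  rw [← Fintype.card_fin r, ← Finset.card_univ]
  refine Finset.card_le_card_of_injOn φ (by simp) fun x hx y hy hxy => ?_
  by_contra hne
  refine h x y hne ?_ hxy
  have key : ∀ w, (w = u ∨ G.Adj u w) → G.edist u w ≤ 1 := fun w hw =>
    SimpleGraph.edist_le_one_iff_adj_or_eq.2 (hw.symm.imp_right Eq.symm)
  have hx' := key x (by simpa using hx)
  have hy' := key y (by simpa using hy)
  calc G.edist x y ≤ G.edist x u + G.edist u y := SimpleGraph.edist_triangle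
    _ ≤ 1 + 1 := by rw [SimpleGraph.edist_comm]; exact add_le_add hx' hy'
    _ < d := by exact_mod_cast (by omega : 1 + 1 < d)

theorem IsKP3Free.dist_lt {V : Type*} {k : ℕ} {G : SimpleGraph V} (h : IsKP3Free k G) {v u : V}
    (hr : G.Reachable v u) : G.dist v u < 4 * k := by
  by_contra! hk
  obtain ⟨p, hp⟩ := hr.exists_walk_length_eq_dist
  -- The path is a geodesic, so the triangle inequality forces equality; distances from `v` then
  -- show that it is induced.
  have hdist : ∀ m ≤ p.length, G.dist v (p.getVert m) = m := fun m hm => by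
    have h1 := G.dist_le (p.take m)
    have h2 := G.dist_le (p.drop m)
    have h3 := SimpleGraph.Reachable.dist_triangle_left ⟨p.take m⟩ u
    rw [SimpleGraph.Walk.take_length] at h1
    rw [SimpleGraph.Walk.drop_length] at h2
    omega
  have hadj : ∀ a b, a < 4 * k → b < 4 * k →
      (G.Adj (p.getVert a) (p.getVert b) ↔ a + 1 = b ∨ b + 1 = a) := fun a b ha hb => by
    constructor
    · intro e
      have := e.diff_dist_adj (u := v)
      have hne : a ≠ b := by rintro rfl; exact e.ne rfl
      rw [hdist a (by omega), hdist b (by omega)] at this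
      omega
    · rintro (rfl | rfl)
      · exact p.adj_getVert_succ (by omega)
      · exact (p.adj_getVert_succ (by omega)).symm
  -- Copy `x.1` takes the first three vertices of its block of four; the skipped fourth separates it
  -- from the next copy.
  refine h ⟨⟨⟨fun x => p.getVert (4 * x.1 + x.2), fun x y hxy => ?_⟩, fun {x y} => ?_⟩⟩
  · have h1 := hdist (4 * x.1 + x.2) (by omega)
    have h2 := hdist (4 * y.1 + y.2) (by omega)
    simp only at hxy
    rw [hxy] at h1
    ext <;> omega
  · refine (hadj (4 * x.1 + x.2) (4 * y.1 + y.2) (by omega) (by omega)).trans ?_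
    simp only [kP3, SimpleGraph.pathGraph_adj, Fin.ext_iff]
    omega

theorem IsDRColoring.exists_finset_reachable {V : Type*} [Fintype V] {d r k : ℕ} (hd : 3 ≤ d)
    {G : SimpleGraph V} (hG : IsKP3Free k G) {φ : V → Fin r} (h : IsDRColoring d G φ) (v : V) :
    ∃ B : Finset V, B.card ≤ r ^ (4 * k) ∧ ∀ u, u ∈ B ↔ G.Reachable v u := by
  classical
  obtain ⟨B, hB, hmem⟩ := exists_finset_walk_length_le (h.exists_finset_neighbors hd) (4 * k) v
  refine ⟨B.filter fun u => G.Reachable v u, (Finset.card_filter_le _ _).trans hB, fun u => ?_⟩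
  rw [Finset.mem_filter, and_iff_right_iff_imp]
  intro hr
  obtain ⟨p, hp⟩ := hr.exists_walk_length_eq_dist
  exact hmem u p (hp.trans_le (hG.dist_lt hr).le)

/-! ### Colorability as a first-order property -/

namespace Instance

variable {r : ℕ} (I : Instance r)

/-- There is a walk of length at most `m` from `u` to `v`. -/
def Near : ℕ → ℕ → ℕ → Prop
  | 0, u, v => u = v
  | m + 1, u, v => u = v ∨ ∃ w < I.n, I.NatAdj u w ∧ Near m w v

theorem near_iff (m : ℕ) (u v : Fin I.n) :
    I.Near m u v ↔ ∃ p : I.graph.Walk u v, p.length ≤ m := by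
  induction m generalizing u with
  | zero =>
    rw [Near, ← Fin.ext_iff]
    refine ⟨?_, fun ⟨p, hp⟩ => SimpleGraph.Walk.eq_of_length_eq_zero (Nat.le_zero.1 hp)⟩
    rintro rfl
    exact ⟨.nil, by simp⟩
  | succ m ih =>
    rw [Near, ← Fin.ext_iff]
    constructor
    · rintro (rfl | ⟨w, hw, ⟨_, _, e⟩, h⟩)
      · exact ⟨.nil, by simp⟩
      · obtain ⟨p, hp⟩ := (ih ⟨w, hw⟩).1 h
        exact ⟨.cons e p, by simpa using hp⟩
    · rintro ⟨p, hp⟩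
      cases p with
      | nil => exact .inl rfl
      | @cons _ w _ e q =>
        exact .inr ⟨w, w.2, ⟨u.2, w.2, e⟩, (ih w).2 ⟨q, by simpa using hp⟩⟩

theorem near_iff_edist_lt {d : ℕ} (hd : 1 ≤ d) (u v : Fin I.n) :
    I.Near (d - 1) u v ↔ I.graph.edist u v < d := by
  rw [near_iff]
  constructor
  · rintro ⟨p, hp⟩
    exact (SimpleGraph.edist_le p).trans_lt (by exact_mod_cast (by omega : p.length < d))
  · intro h
    obtain ⟨p, hp⟩ := SimpleGraph.exists_walk_of_edist_ne_top h.ne_top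
    rw [← hp] at h
    have : p.length < d := by exact_mod_cast h
    exact ⟨p, by omega⟩

/-- The vertices `f 0, …, f (N - 1)` include `v`, are closed under adjacency, and have a
`(d, r)`-coloring. -/
def ColorableOn (d N : ℕ) (f : ℕ → ℕ) (v : ℕ) : Prop :=
  (∃ i : Fin N, f i = v) ∧
  (∀ i : Fin N, ∀ y < I.n, I.NatAdj (f i) y → ∃ j : Fin N, f j = y) ∧
  ∃ c : Fin N → Fin r, ∀ i : Fin N, I.NatList (f i) (c i) ∧ ∀ j : Fin N,
    (f i = f j → c i = c j) ∧ (I.Near (d - 1) (f i) (f j) → ¬ f i = f j → c i ≠ c j)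

/-- Every vertex lies in a union of components that has at most `N` vertices and a coloring. -/
def LocallyColorable (d N : ℕ) : Prop :=
  ∀ v < I.n, ∃ f : ℕ → ℕ, (∀ i < N, f i < I.n) ∧ I.ColorableOn d N f v

end Instance

/-! ### Evaluating local colorability -/

theorem Evaluable.near {r : ℕ} (m x y : ℕ) :
    Evaluable (r := r) fun I e => I.Near m (e x) (e y) := by
  induction m generalizing x with
  | zero => exact Evaluable.eq x y
  | succ m ih =>
    -- The variable `x + y + 1` differs from both `x` and `y`, so nothing is captured.
    refine ((Evaluable.eq x y).or
      (((Evaluable.natAdj x (x + y + 1)).and (ih (x + y + 1))).existsLt (x + y + 1))).congr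
      fun I e => ?_
    have hx : x ≠ x + y + 1 := by omega
    have hy : y ≠ x + y + 1 := by omega
    simp only [Instance.Near, update_self, update_of_ne hx, update_of_ne hy]

/-- Variable `N` holds `v` and is reused for the bound vertex `y` of the closure condition. The
choice of `c` is a case distinction over finitely many functions, fixed in the program. -/
theorem Evaluable.colorableOn {r : ℕ} (d N : ℕ) :
    Evaluable (r := r) fun I e => I.ColorableOn d N e (e N) := by
  refine (exists_fintype fun i : Fin N => Evaluable.eq i N).and (Evaluable.and
    (Evaluable.congr (forall_fintype fun i : Fin N => ((Evaluable.natAdj i N).imp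
      (exists_fintype fun j : Fin N => Evaluable.eq j N)).forallLt N) fun I e => ?_)
    (exists_fintype fun c : Fin N → Fin r => forall_fintype fun i : Fin N =>
      (Evaluable.natList i (c i)).and (forall_fintype fun j : Fin N =>
        ((Evaluable.eq i j).imp (const _)).and
          ((Evaluable.near (d - 1) i j).imp ((Evaluable.eq i j).not.imp (const _))))))
  simp only [update_self, update_of_ne (Fin.is_lt _).ne]

theorem Evaluable.locallyColorable {r : ℕ} (d N : ℕ) :
    Evaluable (r := r) fun I _ => I.LocallyColorable d N := by
  refine (((Evaluable.colorableOn d N).exists_tuple N).forallLt N).congr fun I e => ?_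
  refine forall₂_congr fun v _ => exists_congr fun f => and_congr_right fun _ => ?_
  simp [Instance.ColorableOn]

/-! ### Local and global colorability -/

theorem Instance.LocallyColorable.hasListDRColoring {r d N : ℕ} {I : Instance r} (hd : 1 ≤ d)
    (h : I.LocallyColorable d N) : HasListDRColoring d I.graph I.lists := by
  choose f hf hmem hclosed c hc using fun v : Fin I.n => h v v.2
  -- All vertices of a component must use the same local coloring, that of a chosen representative.
  let rep (v : Fin I.n) : Fin I.n := (I.graph.connectedComponentMk v).out
  have hrep : ∀ u v, I.graph.Reachable u v → rep u = rep v := fun u v huv => by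
    simp only [rep, SimpleGraph.ConnectedComponent.eq.2 huv]
  -- A set closed under adjacency that contains the representative contains its whole component.
  have hreach : ∀ a u v, I.graph.Walk u v → (∃ i : Fin N, f a i = u) → ∃ i : Fin N, f a i = v := by
    intro a u v p hu
    induction p with
    | nil => exact hu
    | @cons u w _ e q ih =>
      obtain ⟨i, hi⟩ := hu
      exact ih (hclosed a i w w.2 (hi ▸ ⟨u.2, w.2, e⟩))
  have hidx : ∀ v : Fin I.n, ∃ i : Fin N, f (rep v) i = v := fun v => by
    have : I.graph.Reachable (rep v) v :=
      SimpleGraph.ConnectedComponent.exact (Quot.out_eq (I.graph.connectedComponentMk v))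
    obtain ⟨p⟩ := this
    exact hreach _ _ _ p (hmem _)
  choose idx hidx using hidx
  refine ⟨fun v => c (rep v) (idx v), fun u v huv hlt => ?_, fun v => ?_⟩
  · have hr := hrep u v (SimpleGraph.reachable_of_edist_ne_top hlt.ne_top)
    have hu := hidx u
    have hv := hidx v
    dsimp only
    rw [← hr] at hv ⊢
    refine ((hc (rep u) (idx u)).2 (idx v)).2 ?_ ?_
    · rwa [hu, hv, I.near_iff_edist_lt hd]
    · rwa [hu, hv, ← Fin.ext_iff]
  · obtain ⟨_, h⟩ := (hc (rep v) (idx v)).1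
    simpa only [hidx] using h

theorem HasListDRColoring.locallyColorable {r d k : ℕ} {I : Instance r} (hd : 3 ≤ d)
    (hI : IsKP3Free k I.graph) (h : HasListDRColoring d I.graph I.lists) :
    I.LocallyColorable d (r ^ (4 * k)) := by
  obtain ⟨φ, hφ, hL⟩ := h
  intro v hv
  obtain ⟨B, hB, hmem⟩ := hφ.exists_finset_reachable hd hI ⟨v, hv⟩
  have hvB : (⟨v, hv⟩ : Fin I.n) ∈ B := (hmem _).2 .rfl
  -- The component may have fewer than `r ^ (4 * k)` vertices, so it is listed with repetitions.
  obtain ⟨g, hg⟩ : ∃ g : Fin (r ^ (4 * k)) → B, Surjective g := by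
    have : Nonempty B := ⟨⟨_, hvB⟩⟩
    obtain ⟨g⟩ := Embedding.nonempty_of_card_le (α := B) (β := Fin (r ^ (4 * k))) (by simpa using hB)
    exact ⟨invFun g, invFun_surjective g.injective⟩
  let f (i : ℕ) : ℕ := if hi : i < r ^ (4 * k) then (g ⟨i, hi⟩ : Fin I.n) else 0
  have hf : ∀ i : Fin (r ^ (4 * k)), f i = (g i : Fin I.n) := fun i => by simp [f]
  have hsurj : ∀ u ∈ B, ∃ i : Fin (r ^ (4 * k)), f i = u := fun u hu => by
    obtain ⟨i, hi⟩ := hg ⟨u, hu⟩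
    exact ⟨i, by rw [hf, hi]⟩
  refine ⟨f, fun i hi => by simp [f, hi], hsurj _ hvB, fun i y hy hadj => ?_,
    fun i => φ (g i), fun i => ⟨?_, fun j => ⟨fun hij => ?_, fun hnear hij => ?_⟩⟩⟩
  · rw [hf] at hadj
    obtain ⟨_, _, e⟩ := hadj
    exact hsurj ⟨y, hy⟩ ((hmem _).2 (((hmem _).1 (g i).2).trans e.reachable))
  · rw [hf]
    exact ⟨(g i : Fin I.n).2, hL _⟩
  · rw [hf, hf, ← Fin.ext_iff] at hij
    exact congrArg φ hij
  · rw [hf, hf] at hnear hij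
    rw [← Fin.ext_iff] at hij
    exact hφ _ _ hij ((I.near_iff_edist_lt (by omega) _ _).1 hnear)

end DistCol

theorem mainTheorem5 (d r k : ℕ) (hd : 6 ≤ d) (hr : 1 ≤ r) (hk : 1 ≤ k) :
    DistCol.PolyTimeSolvableOn (DistCol.Instance.encode (r := r))
      (fun I : DistCol.Instance r => DistCol.IsKP3Free k I.graph)
      (fun I : DistCol.Instance r => DistCol.HasListDRColoring d I.graph I.lists) :=
  (DistCol.Evaluable.locallyColorable d (r ^ (4 * k))).polyTimeSolvableOn _ _
    (fun _ hI => ⟨fun h _ => h.locallyColorable (by omega) hI,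
      -- The sentence has no free variables, so any assignment, such as `0`, will do.
      fun h => (h 0).hasListDRColoring (by omega)⟩) fun _ _ _ h => h
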